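/- A (directed) graph $G$ consists of a finite set $\mathcal V(G)$ of vertices and a finite set $\mathcal E(G)$ of edges, each edge having a source and a target vertex (loops and multiple edges are allowed). $G$ is irreducible if for all vertices $I,J$ there is a directed path (possibly empty) from $I$ to $J$, and weakly connected if any vertex can be reached from any other by traversing edges in either direction. $\lambda_G$ denotes the spectral radius of the adjacency matrix of $G$, whose $(I,J)$ entry is the number of edges from $I$ to $J$. A homomorphism $\Phi: G\to H$ is a pair of maps $\Phi_{\mathcal V}:\mathcal V(G)\to\mathcal V(H)$, $\Phi_{\mathcal E}:\mathcal E(G)\to\mathcal E(H)$ respecting sources and targets. It is bi-resolving (resp. bi-covering) if for each vertex $I$ of $G$ the map $\Phi_{\mathcal E}$ is injective (resp. bijective) from the set of edges starting at $I$ to the set of edges starting at $\Phi_{\mathcal V}(I)$, and likewise from the set of edges ending at $I$ to the set of edges ending at $\Phi_{\mathcal V}(I)$. Its degree is $\deg\Phi=\max_{I\in\mathcal V(H)}|\Phi_{\mathcal V}^{-1}(I)|$. An extension of $\Phi$ is a homomorphism $\tilde\Phi:\tilde G\to H$ such that $\tilde G$ contains $G$ as a subgraph and $\tilde\Phi|_G=\Phi$.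 **Theorem.** Let $\Phi: G\to H$ be a bi-resolving homomorphism of graphs with $H$ irreducible, and let $d=\deg\Phi$. 1. If $G$ is weakly connected, then there exists a bi-covering extension $\tilde\Phi:\tilde G\to H$ of $\Phi$ with $\tilde G$ irreducible and $\deg\tilde\Phi=d$. 2. If $\lambda_H>\lambda_G$ and $n>d$ is an integer, then there exists a bi-covering extension $\tilde\Phi:\tilde G\to H$ of $\Phi$ with $\tilde G$ irreducible and $\deg\tilde\Phi=n$. -/

import Mathlib

universe u

/-- A finite directed graph: finitely many vertices and edges, each edge with a source and a
target. Loops and parallel edges are allowed. -/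
structure FinDigraph where
  V : Type u
  E : Type u
  [fintypeV : Fintype V]
  [fintypeE : Fintype E]
  src : E → V
  tgt : E → V

namespace FinDigraph

attribute [instance] FinDigraph.fintypeV FinDigraph.fintypeE

/-- The edges starting from the vertex `I`. -/
def outEdges (G : FinDigraph.{u}) (I : G.V) : Set G.E := {e | G.src e = I}

/-- The edges ending at the vertex `I`. -/
def inEdges (G : FinDigraph.{u}) (I : G.V) : Set G.E := {e | G.tgt e = I}

/-- Some edge goes from `I` to `J`. -/
def Adj (G : FinDigraph.{u}) (I J : G.V) : Prop := ∃ e : G.E, G.src e = I ∧ G.tgt e = J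

/-- Every vertex can be reached from every vertex by a directed path (the empty path at a vertex
is allowed). -/
def Irreducible (G : FinDigraph.{u}) : Prop :=
  ∀ I J : G.V, Relation.ReflTransGen G.Adj I J

/-- Every vertex can be reached from every vertex by traversing edges in either direction. -/
def WeaklyConnected (G : FinDigraph.{u}) : Prop :=
  ∀ I J : G.V, Relation.ReflTransGen (fun x y => G.Adj x y ∨ G.Adj y x) I J

/-- The adjacency matrix: the entry at `(I, J)` is the number of edges from `I` to `J`. -/
noncomputable def adjMatrix (G : FinDigraph.{u}) : Matrix G.V G.V ℂ :=
  Matrix.of fun I J => (Nat.card {e : G.E // G.src e = I ∧ G.tgt e = J} : ℂ)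

open Classical in
/-- The spectral radius of the adjacency matrix: the largest modulus of a complex eigenvalue. -/
noncomputable def specRadius (G : FinDigraph.{u}) : ENNReal :=
  spectralRadius ℂ G.adjMatrix

/-- A graph homomorphism: a vertex map and an edge map that respect sources and targets. -/
structure Hom (G H : FinDigraph.{u}) where
  onV : G.V → H.V
  onE : G.E → H.E
  src_onE : ∀ e, H.src (onE e) = onV (G.src e)
  tgt_onE : ∀ e, H.tgt (onE e) = onV (G.tgt e)

namespace Hom

variable {G G' H : FinDigraph.{u}}

def RightResolving (Φ : Hom G H) : Prop :=
  ∀ I : G.V, Set.InjOn Φ.onE (G.outEdges I)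

def LeftResolving (Φ : Hom G H) : Prop :=
  ∀ I : G.V, Set.InjOn Φ.onE (G.inEdges I)

def RightCovering (Φ : Hom G H) : Prop :=
  ∀ I : G.V, Set.BijOn Φ.onE (G.outEdges I) (H.outEdges (Φ.onV I))

def LeftCovering (Φ : Hom G H) : Prop :=
  ∀ I : G.V, Set.BijOn Φ.onE (G.inEdges I) (H.inEdges (Φ.onV I))

def BiResolving (Φ : Hom G H) : Prop := Φ.LeftResolving ∧ Φ.RightResolving

def BiCovering (Φ : Hom G H) : Prop := Φ.LeftCovering ∧ Φ.RightCovering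

/-- The degree: the maximum over the vertices `I` of `H` of the number of vertices of `G` that are
mapped to `I`. -/
noncomputable def degree (Φ : Hom G H) : ℕ :=
  Finset.univ.sup fun I : H.V => Nat.card {v : G.V // Φ.onV v = I}

/-- `Ψ : G' → H` extends `Φ : G → H`: the graph `G` sits in `G'` as a subgraph (through a
homomorphism injective on vertices and on edges), and `Ψ` restricts to `Φ` on it. -/
def IsExtension (Ψ : Hom G' H) (Φ : Hom G H) : Prop :=
  ∃ ι : Hom G G', Function.Injective ι.onV ∧ Function.Injective ι.onE ∧
    (∀ v, Ψ.onV (ι.onV v) = Φ.onV v) ∧ (∀ e, Ψ.onE (ι.onE e) = Φ.onE e)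

end Hom

end FinDigraph

/-!
Take `n` disjoint copies of `H` and, for each edge `e` of `H`, permute the targets of the `n` edges
above `e`. Every such *retargeting* is still a bi-covering of `H`, and by bi-resolvingness it can be
chosen so as to contain `G` whenever `n ≥ deg Φ`. In a finite bi-covering of an irreducible graph
every edge lies on a directed cycle, because forward closed sets have equally large fibres over all
vertices; so weak components are irreducible, and each of them covers `H`.

If `n = deg Φ`, some fibre lies entirely in `G`; every component meets it, so a weakly connected `G`
leaves room for only one component.

If `n > deg Φ`, every fibre has a vertex outside `G`. Among the retargetings that fix the edges of
`G`, choose one whose component `A` of such a vertex is as large as possible. Interchanging the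
targets of two edges with the same image, one inside `A` and one outside, would enlarge `A`, so `A`
contains all edges outside `G`. A second component would then be a part of `G` on which `Φ` is
covering, and pulling eigenvectors of `H` back to this part would give `λ_H ≤ λ_G`.
-/

namespace FinDigraph

section Combinatorics

theorem exists_injective_prodMk_of_ncard_fiber_le {α β : Type*} [Finite α] (f : α → β) {n : ℕ}
    (h : ∀ b, (f ⁻¹' {b}).ncard ≤ n) :
    ∃ j : α → Fin n, Function.Injective fun a => (f a, j a) := by
  have hemb (b : β) : Nonempty ({a // f a = b} ↪ Fin n) := by
    have := Fintype.ofFinite {a // f a = b}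
    rw [Function.Embedding.nonempty_iff_card_le, Fintype.card_fin, ← Nat.card_eq_fintype_card]
    exact h b
  let F (b : β) := (hemb b).some
  let i : α ↪ β × Fin n := (Equiv.sigmaFiberEquiv f).symm.toEmbedding.trans <|
    ((Function.Embedding.refl β).sigmaMap F).trans (Equiv.sigmaEquivProd β (Fin n)).toEmbedding
  exact ⟨fun a => (i a).2, i.injective⟩

theorem exists_perm_extending_pair_over {X Y Z : Type*} [Finite X] (p : Y → Z) {a b : X → Y}
    (ha : Function.Injective a) (hb : Function.Injective b) (hab : ∀ x, p (a x) = p (b x)) :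
    ∃ τ : Equiv.Perm Y, (∀ y, p (τ y) = p y) ∧ ∀ x, τ (a x) = b x := by
  have hfiber (z : Z) : ∃ σ : Equiv.Perm {y // p y = z},
      ∀ x : {x // p (a x) = z}, σ ⟨a x, x.2⟩ = ⟨b x, (hab x).symm.trans x.2⟩ :=
    Equiv.Perm.exists_extending_pair _ _
      (fun x x' h => Subtype.ext (ha (congrArg Subtype.val h)))
      (fun x x' h => Subtype.ext (hb (congrArg Subtype.val h)))
  choose σ hσ using hfiber
  exact ⟨Equiv.ofFiberEquiv σ, Equiv.ofFiberEquiv_map σ,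
    fun x => congrArg Subtype.val (hσ (p (a x)) ⟨x, rfl⟩)⟩

end Combinatorics

section Reachability

variable {G K : FinDigraph.{u}}

/-- The vertices to which there is a directed path from `I`. -/
def reach (G : FinDigraph.{u}) (I : G.V) : Set G.V := {J | Relation.ReflTransGen G.Adj I J}

/-- The weakly connected component of `I`. -/
def weakComponent (G : FinDigraph.{u}) (I : G.V) : Set G.V :=
  {J | Relation.ReflTransGen (fun x y => G.Adj x y ∨ G.Adj y x) I J}

/-- A set of vertices that no edge leaves. -/
def ForwardClosed (G : FinDigraph.{u}) (S : Set G.V) : Prop := ∀ e, G.src e ∈ S → G.tgt e ∈ S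

/-- A set of vertices that no edge enters or leaves, that is, a union of weakly connected
components. -/
def Invariant (G : FinDigraph.{u}) (S : Set G.V) : Prop := ∀ e, G.src e ∈ S ↔ G.tgt e ∈ S

/-- Every edge lies on a directed cycle, expressed by a path from its target back to its source. -/
def Nonwandering (G : FinDigraph.{u}) : Prop := ∀ e, G.src e ∈ G.reach (G.tgt e)

theorem mem_reach_self (I : G.V) : I ∈ G.reach I := Relation.ReflTransGen.refl

theorem forwardClosed_reach (I : G.V) : G.ForwardClosed (G.reach I) :=
  fun e he => Relation.ReflTransGen.tail he ⟨e, rfl, rfl⟩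

theorem ForwardClosed.reach_subset {S : Set G.V} (hS : G.ForwardClosed S) {I : G.V} (hI : I ∈ S) :
    G.reach I ⊆ S := by
  intro J hJ
  induction hJ with
  | refl => exact hI
  | tail _ hadj ih =>
    obtain ⟨e, rfl, rfl⟩ := hadj
    exact hS e ih

theorem Irreducible.eq_univ_of_forwardClosed (hG : G.Irreducible) {S : Set G.V}
    (hS : G.ForwardClosed S) (hne : S.Nonempty) : S = Set.univ :=
  let ⟨I, hI⟩ := hne
  Set.eq_univ_of_forall fun J => hS.reach_subset hI (hG I J)

theorem Invariant.forwardClosed {S : Set G.V} (hS : G.Invariant S) : G.ForwardClosed S :=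
  fun e => (hS e).1

theorem Invariant.compl {S : Set G.V} (hS : G.Invariant S) : G.Invariant Sᶜ :=
  fun e => not_congr (hS e)

theorem Invariant.preimage {S : Set K.V} (hS : K.Invariant S) (ι : Hom G K) :
    G.Invariant (ι.onV ⁻¹' S) := fun e => by
  simpa only [Set.mem_preimage, ι.src_onE, ι.tgt_onE] using hS (ι.onE e)

theorem Invariant.weakComponent_subset {S : Set G.V} (hS : G.Invariant S) {I : G.V} (hI : I ∈ S) :
    G.weakComponent I ⊆ S := by
  intro J hJ
  induction hJ with
  | refl => exact hI
  | tail _ hadj ih =>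
    rcases hadj with ⟨e, rfl, rfl⟩ | ⟨e, rfl, rfl⟩
    · exact (hS e).1 ih
    · exact (hS e).2 ih

theorem mem_weakComponent_self (I : G.V) : I ∈ G.weakComponent I := Relation.ReflTransGen.refl

theorem invariant_weakComponent (I : G.V) : G.Invariant (G.weakComponent I) := fun e =>
  ⟨fun he => Relation.ReflTransGen.tail he (Or.inl ⟨e, rfl, rfl⟩),
    fun he => Relation.ReflTransGen.tail he (Or.inr ⟨e, rfl, rfl⟩)⟩

theorem Nonwandering.invariant (hG : G.Nonwandering) {S : Set G.V} (hS : G.ForwardClosed S) :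
    G.Invariant S := fun e => ⟨hS e, fun he => hS.reach_subset he (hG e)⟩

theorem Nonwandering.mem_reach_symm (hG : G.Nonwandering) {I J : G.V} (hJ : J ∈ G.reach I) :
    I ∈ G.reach J := by
  by_contra hI
  have hcompl := (hG.invariant (forwardClosed_reach J)).compl.forwardClosed
  exact hcompl.reach_subset hI hJ (mem_reach_self J)

theorem Nonwandering.irreducible_of_reach_eq_univ (hG : G.Nonwandering) {I : G.V}
    (hI : G.reach I = Set.univ) : G.Irreducible := fun J K =>
  (hG.mem_reach_symm (hI ▸ Set.mem_univ J)).trans (hI ▸ Set.mem_univ K : K ∈ G.reach I)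

/-- The boundary of a set of vertices cannot consist of one edge, as that edge lies on a cycle. -/
theorem Nonwandering.forwardClosed_of_forall_ne (hG : G.Nonwandering) {S : Set G.V} (g : G.E)
    (hS : ∀ e ≠ g, G.src e ∈ S ↔ G.tgt e ∈ S) : G.ForwardClosed S := by
  by_cases hg : G.tgt g ∈ S
  · intro e he
    rcases eq_or_ne e g with rfl | hne
    · exact hg
    · exact (hS e hne).1 he
  · have hcompl : G.ForwardClosed Sᶜ := by
      intro e he
      rcases eq_or_ne e g with rfl | hne
      · exact hg
      · exact (not_congr (hS e hne)).1 he
    simpa only [compl_compl] using (hG.invariant hcompl).compl.forwardClosed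

end Reachability

namespace Hom

variable {G H K : FinDigraph.{u}}

section Covering

/-- The covering condition on outgoing edges at the single vertex `v`. -/
def RightCoveringAt (Φ : Hom G H) (v : G.V) : Prop :=
  Set.BijOn Φ.onE (G.outEdges v) (H.outEdges (Φ.onV v))

theorem BiCovering.leftResolving {Ψ : Hom K H} (hΨ : Ψ.BiCovering) : Ψ.LeftResolving :=
  fun I => (hΨ.1 I).injOn

theorem image_onV_eq_univ (Φ : Hom G H) (hH : H.Irreducible) {S : Set G.V}
    (hS : G.ForwardClosed S) (hne : S.Nonempty) (hcov : ∀ v ∈ S, Φ.RightCoveringAt v) :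
    Φ.onV '' S = Set.univ := by
  refine hH.eq_univ_of_forwardClosed ?_ (hne.image Φ.onV)
  rintro e ⟨v, hv, hve⟩
  obtain ⟨g, rfl, rfl⟩ := (hcov v hv).surjOn hve.symm
  exact ⟨G.tgt g, hS g hv, (Φ.tgt_onE g).symm⟩

section Counting

variable {Ψ : Hom K H} {S : Set K.V}

theorem RightCovering.ncard_inter_fiber_src (hr : Ψ.RightCovering) (S : Set K.V) (e : H.E) :
    (S ∩ Ψ.onV ⁻¹' {H.src e}).ncard = {g | Ψ.onE g = e ∧ K.src g ∈ S}.ncard := by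
  refine (Set.BijOn.ncard_eq (f := K.src) ⟨?_, ?_, ?_⟩).symm
  · rintro g ⟨rfl, hg⟩
    exact ⟨hg, (Ψ.src_onE g).symm⟩
  · rintro g ⟨hge, -⟩ g' ⟨hge', -⟩ hsrc
    exact (hr _).injOn hsrc rfl (hge.trans hge'.symm)
  · rintro v ⟨hv, hve⟩
    obtain ⟨g, rfl, hge⟩ := (hr v).surjOn (Eq.symm hve)
    exact ⟨g, ⟨hge, hv⟩, rfl⟩

theorem LeftResolving.injOn_tgt (hl : Ψ.LeftResolving) (e : H.E) :
    Set.InjOn K.tgt {g | Ψ.onE g = e} :=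
  fun _ hge _ hge' htgt => hl _ htgt rfl (Eq.trans hge (Eq.symm hge'))

theorem image_tgt_subset (hS : K.ForwardClosed S) (e : H.E) :
    K.tgt '' {g | Ψ.onE g = e ∧ K.src g ∈ S} ⊆ S ∩ Ψ.onV ⁻¹' {H.tgt e} := by
  rintro _ ⟨g, ⟨rfl, hg⟩, rfl⟩
  exact ⟨hS g hg, (Ψ.tgt_onE g).symm⟩

theorem LeftResolving.ncard_image_tgt (hl : Ψ.LeftResolving) (S : Set K.V) (e : H.E) :
    (K.tgt '' {g | Ψ.onE g = e ∧ K.src g ∈ S}).ncard =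
      {g | Ψ.onE g = e ∧ K.src g ∈ S}.ncard :=
  ((hl.injOn_tgt e).mono fun _ hg => hg.1).ncard_image

theorem RightCovering.ncard_inter_fiber_eq (hr : Ψ.RightCovering) (hl : Ψ.LeftResolving)
    (hH : H.Irreducible) (hS : K.ForwardClosed S) (I J : H.V) :
    (S ∩ Ψ.onV ⁻¹' {I}).ncard = (S ∩ Ψ.onV ⁻¹' {J}).ncard := by
  have hle (I J : H.V) : (S ∩ Ψ.onV ⁻¹' {I}).ncard ≤ (S ∩ Ψ.onV ⁻¹' {J}).ncard := by
    have hclosed :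
        H.ForwardClosed {J | (S ∩ Ψ.onV ⁻¹' {I}).ncard ≤ (S ∩ Ψ.onV ⁻¹' {J}).ncard} := by
      intro e he
      calc (S ∩ Ψ.onV ⁻¹' {I}).ncard
          ≤ (S ∩ Ψ.onV ⁻¹' {H.src e}).ncard := he
        _ = (K.tgt '' {g | Ψ.onE g = e ∧ K.src g ∈ S}).ncard := by
          rw [hr.ncard_inter_fiber_src, hl.ncard_image_tgt]
        _ ≤ (S ∩ Ψ.onV ⁻¹' {H.tgt e}).ncard := Set.ncard_le_ncard (image_tgt_subset hS e)
    have huniv := hH.eq_univ_of_forwardClosed hclosed ⟨I, Set.mem_ofPred.2 le_rfl⟩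
    exact Set.eq_univ_iff_forall.1 huniv J
  exact (hle I J).antisymm (hle J I)

theorem RightCovering.nonwandering (hr : Ψ.RightCovering) (hl : Ψ.LeftResolving)
    (hH : H.Irreducible) : K.Nonwandering := by
  intro g
  have hS := forwardClosed_reach (K.tgt g)
  have himage := Set.eq_of_subset_of_ncard_le (image_tgt_subset (Ψ := Ψ) hS (Ψ.onE g)) <| by
    rw [hl.ncard_image_tgt, ← hr.ncard_inter_fiber_src, hr.ncard_inter_fiber_eq hl hH hS]
  have hg : K.tgt g ∈ K.reach (K.tgt g) ∩ Ψ.onV ⁻¹' {H.tgt (Ψ.onE g)} :=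
    ⟨mem_reach_self _, (Ψ.tgt_onE g).symm⟩
  rw [← himage] at hg
  obtain ⟨g', ⟨hΨ, hg'⟩, htgt⟩ := hg
  rwa [hl.injOn_tgt _ hΨ rfl htgt] at hg'

end Counting

theorem BiCovering.nonwandering {Ψ : Hom K H} (hΨ : Ψ.BiCovering) (hH : H.Irreducible) :
    K.Nonwandering :=
  RightCovering.nonwandering hΨ.2 hΨ.leftResolving hH

end Covering

section Degree

theorem degree_eq_sup (Φ : Hom G H) :
    Φ.degree = Finset.univ.sup fun I => (Φ.onV ⁻¹' {I}).ncard := rfl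

theorem ncard_fiber_le_degree (Φ : Hom G H) (I : H.V) : (Φ.onV ⁻¹' {I}).ncard ≤ Φ.degree :=
  Finset.le_sup (f := fun I => (Φ.onV ⁻¹' {I}).ncard) (Finset.mem_univ I)

theorem exists_ncard_fiber_eq_degree [Nonempty H.V] (Φ : Hom G H) :
    ∃ I, (Φ.onV ⁻¹' {I}).ncard = Φ.degree :=
  let ⟨I, _, hI⟩ := Finset.exists_mem_eq_sup Finset.univ Finset.univ_nonempty
    fun I => (Φ.onV ⁻¹' {I}).ncard
  ⟨I, hI.symm⟩

theorem BiCovering.ncard_fiber_eq_degree {Ψ : Hom K H} (hΨ : Ψ.BiCovering) (hH : H.Irreducible)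
    (I : H.V) : (Ψ.onV ⁻¹' {I}).ncard = Ψ.degree := by
  have : Nonempty H.V := ⟨I⟩
  obtain ⟨J, hJ⟩ := Ψ.exists_ncard_fiber_eq_degree
  have hIJ := RightCovering.ncard_inter_fiber_eq hΨ.2 hΨ.leftResolving hH
    (fun _ _ => Set.mem_univ _ : K.ForwardClosed Set.univ) I J
  rwa [Set.univ_inter, Set.univ_inter, hJ] at hIJ

end Degree

section Embedding

/-- The map `ι` realizes `G` as a subgraph of `K` on which `Ψ` restricts to `Φ`. -/
structure IsEmbeddingOver (ι : Hom G K) (Φ : Hom G H) (Ψ : Hom K H) : Prop where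
  injective_onV : Function.Injective ι.onV
  injective_onE : Function.Injective ι.onE
  onV_onV : ∀ v, Ψ.onV (ι.onV v) = Φ.onV v
  onE_onE : ∀ e, Ψ.onE (ι.onE e) = Φ.onE e

variable {ι : Hom G K} {Φ : Hom G H} {Ψ : Hom K H}

theorem IsEmbeddingOver.isExtension (hι : ι.IsEmbeddingOver Φ Ψ) : Ψ.IsExtension Φ :=
  ⟨ι, hι.injective_onV, hι.injective_onE, hι.onV_onV, hι.onE_onE⟩

theorem IsExtension.exists_isEmbeddingOver (h : Ψ.IsExtension Φ) :
    ∃ ι : Hom G K, ι.IsEmbeddingOver Φ Ψ :=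
  let ⟨ι, hV, hE, hΨV, hΨE⟩ := h
  ⟨ι, hV, hE, hΨV, hΨE⟩

theorem IsExtension.refl (Φ : Hom G H) : Φ.IsExtension Φ :=
  ⟨⟨id, id, fun _ => rfl, fun _ => rfl⟩, Function.injective_id, Function.injective_id,
    fun _ => rfl, fun _ => rfl⟩

theorem IsEmbeddingOver.ncard_image_fiber (hι : ι.IsEmbeddingOver Φ Ψ) (I : H.V) :
    (ι.onV '' (Φ.onV ⁻¹' {I})).ncard = (Φ.onV ⁻¹' {I}).ncard :=
  Set.ncard_image_of_injective _ hι.injective_onV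

theorem IsEmbeddingOver.rightCoveringAt (hι : ι.IsEmbeddingOver Φ Ψ) {v : G.V}
    (hv : K.outEdges (ι.onV v) ⊆ Set.range ι.onE) (hΨ : Ψ.RightCoveringAt (ι.onV v)) :
    Φ.RightCoveringAt v := by
  have hιE : Set.BijOn ι.onE (G.outEdges v) (K.outEdges (ι.onV v)) := by
    refine ⟨?_, hι.injective_onE.injOn, ?_⟩
    · rintro e rfl
      exact ι.src_onE e
    · intro e he
      obtain ⟨g, rfl⟩ := hv he
      exact ⟨g, hι.injective_onV ((ι.src_onE g).symm.trans he), rfl⟩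
  have hcomp := hΨ.comp hιE
  rw [hι.onV_onV] at hcomp
  exact hcomp.congr fun e _ => hι.onE_onE e

theorem IsEmbeddingOver.exists_notMem_range (hι : ι.IsEmbeddingOver Φ Ψ) (hΨ : Ψ.BiCovering)
    (hH : H.Irreducible) (hdeg : Φ.degree < Ψ.degree) (I : H.V) :
    ∃ y ∉ Set.range ι.onV, Ψ.onV y = I := by
  have hlt : (ι.onV '' (Φ.onV ⁻¹' {I})).ncard < (Ψ.onV ⁻¹' {I}).ncard := by
    rw [hι.ncard_image_fiber, hΨ.ncard_fiber_eq_degree hH]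
    exact (Φ.ncard_fiber_le_degree I).trans_lt hdeg
  obtain ⟨y, hy, hyι⟩ := Set.exists_mem_notMem_of_ncard_lt_ncard hlt
  refine ⟨y, ?_, hy⟩
  rintro ⟨v, rfl⟩
  exact hyι ⟨v, (hι.onV_onV v).symm.trans hy, rfl⟩

/-- Some fibre of `Ψ` lies in the weakly connected graph `G` and meets every component of `K`. -/
theorem IsExtension.irreducible_of_degree_le (h : Ψ.IsExtension Φ) (hΨ : Ψ.BiCovering)
    (hH : H.Irreducible) (hG : G.WeaklyConnected) (hdeg : Ψ.degree ≤ Φ.degree) :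
    K.Irreducible := by
  obtain ⟨ι, hι⟩ := h.exists_isEmbeddingOver
  have hK := hΨ.nonwandering hH
  intro x y
  have : Nonempty H.V := ⟨Ψ.onV x⟩
  obtain ⟨I, hI⟩ := Φ.exists_ncard_fiber_eq_degree
  have hfiber : ι.onV '' (Φ.onV ⁻¹' {I}) = Ψ.onV ⁻¹' {I} := by
    refine Set.eq_of_subset_of_ncard_le ?_ ?_
    · rintro _ ⟨v, hv, rfl⟩
      exact (hι.onV_onV v).trans hv
    · rw [hι.ncard_image_fiber, hI]
      exact (Ψ.ncard_fiber_le_degree I).trans hdeg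
  have hmeets (z : K.V) : ∃ v, ι.onV v ∈ K.reach z := by
    obtain ⟨w, hw, hwI⟩ : I ∈ Ψ.onV '' K.reach z := by
      rw [Ψ.image_onV_eq_univ hH (forwardClosed_reach z) ⟨z, mem_reach_self z⟩ fun w _ => hΨ.2 w]
      exact Set.mem_univ I
    obtain ⟨v, -, rfl⟩ := hfiber.symm.subset hwI
    exact ⟨v, hw⟩
  obtain ⟨v, hv⟩ := hmeets x
  obtain ⟨w, hw⟩ := hmeets y
  have hx := (hK.invariant (forwardClosed_reach x)).preimage ι
  exact (hx.weakComponent_subset hv (hG v w) : ι.onV w ∈ K.reach x).trans (hK.mem_reach_symm hw)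

end Embedding

end Hom

section Retargeting

variable {G H K : FinDigraph.{u}}

/-- The graph `K` with the targets of its edges permuted by `τ`. -/
abbrev retarget (K : FinDigraph.{u}) (τ : Equiv.Perm K.E) : FinDigraph.{u} where
  V := K.V
  E := K.E
  src := K.src
  tgt := K.tgt ∘ τ

/-- A homomorphism whose edge map is invariant under `τ` remains one after retargeting its
domain by `τ`. -/
def Hom.retarget (Ψ : Hom K H) (τ : Equiv.Perm K.E) (hτ : ∀ e, Ψ.onE (τ e) = Ψ.onE e) :
    Hom (K.retarget τ) H where
  onV := Ψ.onV
  onE := Ψ.onE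
  src_onE := Ψ.src_onE
  tgt_onE e := (congrArg H.tgt (hτ e)).symm.trans (Ψ.tgt_onE (τ e))

theorem Hom.BiCovering.retarget {Ψ : Hom K H} (hΨ : Ψ.BiCovering) {τ : Equiv.Perm K.E}
    (hτ : ∀ e, Ψ.onE (τ e) = Ψ.onE e) : (Ψ.retarget τ hτ).BiCovering := by
  refine ⟨fun I => ?_, hΨ.2⟩
  have hin : Set.BijOn τ ((K.retarget τ).inEdges I) (K.inEdges I) :=
    τ.bijOn fun _ => Iff.rfl
  exact ((hΨ.1 I).comp hin).congr fun e _ => hτ e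

/-- The edge `e` of `G` is sent to the lift of `Φ e` that starts at the source of `e`, and `τ`
takes this lift to the one that ends at the target of `e`. -/
theorem Hom.BiCovering.exists_retarget_isExtension {Φ : Hom G H} (hΦ : Φ.BiResolving)
    {Ψ : Hom K H} (hΨ : Ψ.BiCovering) {i : G.V → K.V} (hi : Function.Injective i)
    (hiΨ : ∀ v, Ψ.onV (i v) = Φ.onV v) :
    ∃ (τ : Equiv.Perm K.E) (hτ : ∀ e, Ψ.onE (τ e) = Ψ.onE e),
      (Ψ.retarget τ hτ).IsExtension Φ := by
  have hout (g : G.E) : ∃ e, K.src e = i (G.src g) ∧ Ψ.onE e = Φ.onE g :=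
    (hΨ.2 _).surjOn ((Φ.src_onE g).trans (hiΨ _).symm)
  have hin (g : G.E) : ∃ e, K.tgt e = i (G.tgt g) ∧ Ψ.onE e = Φ.onE g :=
    (hΨ.1 _).surjOn ((Φ.tgt_onE g).trans (hiΨ _).symm)
  choose a ha haΨ using hout
  choose b hb hbΨ using hin
  have ha_inj : Function.Injective a := fun g g' h =>
    hΦ.2 _ rfl (hi (by rw [← ha, ← ha, h])) (by rw [← haΨ, ← haΨ, h])
  have hb_inj : Function.Injective b := fun g g' h =>
    hΦ.1 _ rfl (hi (by rw [← hb, ← hb, h])) (by rw [← hbΨ, ← hbΨ, h])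
  obtain ⟨τ, hτ, hτab⟩ := exists_perm_extending_pair_over Ψ.onE ha_inj hb_inj
    fun g => (haΨ g).trans (hbΨ g).symm
  let ι : Hom G (K.retarget τ) :=
    { onV := i
      onE := a
      src_onE := ha
      tgt_onE := fun g => (congrArg K.tgt (hτab g)).trans (hb g) }
  exact ⟨τ, hτ, ι, hi, ha_inj, hiΨ, haΨ⟩

/-- The retargeting exchanges the target of the edge `g`, inside the component of `x`, with that of
`g'`, outside of it; the old component persists since no set of vertices has `g` as its only
boundary edge. -/
theorem Nonwandering.reach_ssubset_reach_retarget_swap [DecidableEq K.E] (hK : K.Nonwandering)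
    {g g' : K.E} (hK' : (K.retarget (Equiv.swap g g')).Nonwandering) {x : K.V}
    (hg : K.src g ∈ K.reach x) (hg' : K.src g' ∉ K.reach x) :
    K.reach x ⊂ (K.retarget (Equiv.swap g g')).reach x := by
  let K' := K.retarget (Equiv.swap g g')
  have hA : K.Invariant (K.reach x) := hK.invariant (forwardClosed_reach x)
  have hA' : K'.Invariant (K'.reach x) := hK'.invariant (forwardClosed_reach (G := K') x)
  have hinter : K.ForwardClosed (K.reach x ∩ K'.reach x) := by
    refine hK.forwardClosed_of_forall_ne g fun e hne => ?_
    rw [Set.mem_inter_iff, Set.mem_inter_iff, ← hA e]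
    refine and_congr_right fun he => ?_
    have htgt : K'.tgt e = K.tgt e :=
      congrArg K.tgt (Equiv.swap_apply_of_ne_of_ne hne fun h => hg' (h ▸ he))
    rw [← htgt]
    exact hA' e
  have hsub : K.reach x ⊆ K'.reach x := fun y hy =>
    (hinter.reach_subset ⟨mem_reach_self x, mem_reach_self (G := K') x⟩ hy).2
  have htgt : K.tgt g' ∈ K'.reach x := by
    rw [← Equiv.swap_apply_left g g']
    exact (hA' g).1 (hsub hg)
  exact ⟨hsub, fun h => hg' ((hA g').2 (h htgt))⟩

theorem Hom.BiCovering.exists_retarget_forall_src_mem_reach {Ψ : Hom K H} (hΨ : Ψ.BiCovering)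
    (hH : H.Irreducible) (F : Set K.E) (x : K.V) :
    ∃ τ : Equiv.Perm K.E, (∀ e, Ψ.onE (τ e) = Ψ.onE e) ∧ (∀ e ∈ F, τ e = e) ∧
      ∀ g ∉ F, ∀ g' ∉ F, Ψ.onE g = Ψ.onE g' →
        K.src g ∈ (K.retarget τ).reach x → K.src g' ∈ (K.retarget τ).reach x := by
  classical
  obtain ⟨τ, ⟨hτ, hτF⟩, hmax⟩ := Set.exists_max_image
    {τ : Equiv.Perm K.E | (∀ e, Ψ.onE (τ e) = Ψ.onE e) ∧ ∀ e ∈ F, τ e = e}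
    (fun τ => ((K.retarget τ).reach x).ncard) (Set.toFinite _) ⟨1, fun _ => rfl, fun _ _ => rfl⟩
  refine ⟨τ, hτ, hτF, fun g hg g' hg' hgg' hsrc => ?_⟩
  by_contra hsrc'
  have hswap (e : K.E) : Ψ.onE (Equiv.swap g g' e) = Ψ.onE e := Equiv.apply_swap_eq_self hgg' e
  have hcov := hΨ.retarget hτ
  have hlt := Set.ncard_lt_ncard <| (hcov.nonwandering hH).reach_ssubset_reach_retarget_swap
    ((hcov.retarget hswap).nonwandering hH) hsrc hsrc'
  have hmem : τ * Equiv.swap g g' ∈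
      {τ : Equiv.Perm K.E | (∀ e, Ψ.onE (τ e) = Ψ.onE e) ∧ ∀ e ∈ F, τ e = e} := by
    refine ⟨fun e => (hτ _).trans (hswap e), fun e he => ?_⟩
    rw [Equiv.Perm.mul_apply, Equiv.swap_apply_of_ne_of_ne (ne_of_mem_of_not_mem he hg)
      (ne_of_mem_of_not_mem he hg'), hτF e he]
  exact (hmax _ hmem).not_gt hlt

end Retargeting

section Copies

/-- The disjoint union of `n` copies of `H`. -/
abbrev copies (H : FinDigraph.{u}) (n : ℕ) : FinDigraph.{u} where
  V := H.V × Fin n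
  E := H.E × Fin n
  src := Prod.map H.src id
  tgt := Prod.map H.tgt id

/-- The homomorphism that identifies the copies of `H`. -/
def copiesHom (H : FinDigraph.{u}) (n : ℕ) : Hom (H.copies n) H where
  onV := Prod.fst
  onE := Prod.fst
  src_onE _ := rfl
  tgt_onE _ := rfl

variable {G H : FinDigraph.{u}} {n : ℕ}

theorem biCovering_copiesHom : (H.copiesHom n).BiCovering := by
  have bijOn_fst (f : H.E → H.V) (I : H.V × Fin n) :
      Set.BijOn Prod.fst {e | Prod.map f id e = I} {e | f e = I.1} := by
    refine ⟨?_, ?_, fun e he => ⟨(e, I.2), Prod.ext he rfl, rfl⟩⟩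
    · rintro e rfl
      exact rfl
    · rintro e rfl e' he' hfst
      exact Prod.ext hfst (congrArg Prod.snd he').symm
  exact ⟨bijOn_fst H.tgt, bijOn_fst H.src⟩

theorem degree_copiesHom [Nonempty H.V] : (H.copiesHom n).degree = n := by
  have hfiber (I : H.V) : ((H.copiesHom n).onV ⁻¹' {I}).ncard = n := by
    have hprod : (H.copiesHom n).onV ⁻¹' {I} = {I} ×ˢ Set.univ := Set.prod_univ.symm
    rw [hprod, Set.ncard_prod, Set.ncard_singleton, Set.ncard_univ, Nat.card_fin, one_mul]
  simp only [Hom.degree_eq_sup, hfiber]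
  exact Finset.sup_const Finset.univ_nonempty n

theorem Hom.BiResolving.exists_biCovering_isExtension [Nonempty H.V] {Φ : Hom G H}
    (hΦ : Φ.BiResolving) (hn : Φ.degree ≤ n) :
    ∃ (K : FinDigraph.{u}) (Ψ : Hom K H), Ψ.BiCovering ∧ Ψ.IsExtension Φ ∧ Ψ.degree = n := by
  obtain ⟨j, hj⟩ := exists_injective_prodMk_of_ncard_fiber_le Φ.onV
    fun I => (Φ.ncard_fiber_le_degree I).trans hn
  obtain ⟨τ, hτ, hext⟩ := biCovering_copiesHom.exists_retarget_isExtension hΦ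
    (Ψ := H.copiesHom n) hj fun _ => rfl
  exact ⟨_, _, biCovering_copiesHom.retarget hτ, hext, degree_copiesHom⟩

end Copies

section Irreducibility

variable {G H K : FinDigraph.{u}} {Φ : Hom G H} {Ψ : Hom K H} {ι : Hom G K}

/-- By `hmax`, the component of `x` has a vertex outside `G` over every vertex of `H`, hence an edge
outside `G` over every edge of `H`. -/
theorem Hom.IsEmbeddingOver.src_mem_reach_of_notMem_range (hι : ι.IsEmbeddingOver Φ Ψ)
    (hΨ : Ψ.BiCovering) (hH : H.Irreducible) (hdeg : Φ.degree < Ψ.degree) {x : K.V}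
    (hx : x ∉ Set.range ι.onV)
    (hmax : ∀ g ∉ Set.range ι.onE, ∀ g' ∉ Set.range ι.onE, Ψ.onE g = Ψ.onE g' →
      K.src g ∈ K.reach x → K.src g' ∈ K.reach x)
    {g : K.E} (hg : g ∉ Set.range ι.onE) : K.src g ∈ K.reach x := by
  have notMem_of_src {g : K.E} (h : K.src g ∉ Set.range ι.onV) : g ∉ Set.range ι.onE := by
    rintro ⟨e, rfl⟩
    exact h ⟨G.src e, (ι.src_onE e).symm⟩
  have notMem_of_tgt {g : K.E} (h : K.tgt g ∉ Set.range ι.onV) : g ∉ Set.range ι.onE := by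
    rintro ⟨e, rfl⟩
    exact h ⟨G.tgt e, (ι.tgt_onE e).symm⟩
  have hspare : Ψ.onV '' (K.reach x \ Set.range ι.onV) = Set.univ := by
    refine hH.eq_univ_of_forwardClosed ?_ ⟨_, x, ⟨mem_reach_self x, hx⟩, rfl⟩
    rintro e ⟨y, ⟨hy, hyι⟩, hye⟩
    obtain ⟨z, hzι, hz⟩ := hι.exists_notMem_range hΨ hH hdeg (H.tgt e)
    obtain ⟨g, rfl, hge⟩ := (hΨ.2 y).surjOn hye.symm
    obtain ⟨g', rfl, hge'⟩ := (hΨ.1 z).surjOn hz.symm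
    have hsrc := hmax g (notMem_of_src hyι) g' (notMem_of_tgt hzι) (hge.trans hge'.symm) hy
    exact ⟨K.tgt g', ⟨forwardClosed_reach x g' hsrc, hzι⟩, hz⟩
  obtain ⟨y, ⟨hy, hyι⟩, hyg⟩ := hspare.symm.subset (Set.mem_univ (H.src (Ψ.onE g)))
  obtain ⟨g', rfl, hΨg'⟩ := (hΨ.2 y).surjOn hyg.symm
  exact hmax g' (notMem_of_src hyι) g hg hΨg' hy

theorem Hom.IsEmbeddingOver.reach_eq_univ [Nonempty H.E] (hι : ι.IsEmbeddingOver Φ Ψ)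
    (hΨ : Ψ.BiCovering) (hH : H.Irreducible)
    (hG : ∀ v, ∃ w ∈ G.weakComponent v, ¬ Φ.RightCoveringAt w) {x : K.V}
    (hx : ∀ g ∉ Set.range ι.onE, K.src g ∈ K.reach x) : K.reach x = Set.univ := by
  have hcompl : K.Invariant (K.reach x)ᶜ :=
    ((hΨ.nonwandering hH).invariant (forwardClosed_reach x)).compl
  have hout {z : K.V} (hz : z ∉ K.reach x) : K.outEdges z ⊆ Set.range ι.onE := by
    rintro g rfl
    exact not_imp_comm.1 (hx g) hz
  by_contra hne
  have hsurj := Ψ.image_onV_eq_univ hH hcompl.forwardClosed (Set.nonempty_compl.2 hne)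
    fun v _ => hΨ.2 v
  obtain ⟨e⟩ := ‹Nonempty H.E›
  obtain ⟨z, hz, hze⟩ := hsurj.symm.subset (Set.mem_univ (H.src e))
  obtain ⟨g, hgz, -⟩ := (hΨ.2 z).surjOn hze.symm
  obtain ⟨g, rfl⟩ := hout hz hgz
  have hv : ι.onV (G.src g) ∈ (K.reach x)ᶜ := by
    rw [← ι.src_onE, (hgz : K.src _ = z)]
    exact hz
  obtain ⟨w, hw, hwΦ⟩ := hG (G.src g)
  have hwx : ι.onV w ∉ K.reach x := (hcompl.preimage ι).weakComponent_subset hv hw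
  exact hwΦ (hι.rightCoveringAt (hout hwx) (hΨ.2 _))

theorem Hom.IsExtension.exists_retarget_irreducible [Nonempty H.E] (h : Ψ.IsExtension Φ)
    (hΨ : Ψ.BiCovering) (hH : H.Irreducible)
    (hG : ∀ v, ∃ w ∈ G.weakComponent v, ¬ Φ.RightCoveringAt w) (hdeg : Φ.degree < Ψ.degree) :
    ∃ (τ : Equiv.Perm K.E) (hτ : ∀ e, Ψ.onE (τ e) = Ψ.onE e),
      (Ψ.retarget τ hτ).IsExtension Φ ∧ (K.retarget τ).Irreducible := by
  obtain ⟨ι, hι⟩ := h.exists_isEmbeddingOver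
  obtain ⟨e⟩ := ‹Nonempty H.E›
  obtain ⟨x, hx, -⟩ := hι.exists_notMem_range hΨ hH hdeg (H.src e)
  obtain ⟨τ, hτ, hτι, hmax⟩ :=
    hΨ.exists_retarget_forall_src_mem_reach hH (Set.range ι.onE) x
  let ι' : Hom G (K.retarget τ) :=
    { onV := ι.onV
      onE := ι.onE
      src_onE := ι.src_onE
      tgt_onE := fun g => (congrArg K.tgt (hτι _ ⟨g, rfl⟩)).trans (ι.tgt_onE g) }
  have hι' : ι'.IsEmbeddingOver Φ (Ψ.retarget τ hτ) :=
    ⟨hι.injective_onV, hι.injective_onE, hι.onV_onV, hι.onE_onE⟩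
  have hΨ' := hΨ.retarget hτ
  have : Nonempty H.E := ⟨e⟩
  have hreach := hι'.reach_eq_univ hΨ' hH hG fun g hg =>
    hι'.src_mem_reach_of_notMem_range hΨ' hH hdeg hx hmax hg
  exact ⟨τ, hτ, hι'.isExtension, (hΨ'.nonwandering hH).irreducible_of_reach_eq_univ hreach⟩

end Irreducibility

section SpectralRadius

variable {G H : FinDigraph.{u}}

open Matrix

open Classical in
theorem adjMatrix_mulVec (G : FinDigraph.{u}) (y : G.V → ℂ) (v : G.V) :
    (G.adjMatrix *ᵥ y) v = ∑ g with G.src g = v, y (G.tgt g) := by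
  have hentry (w : G.V) : G.adjMatrix v w * y w =
      ∑ g with G.src g = v, if G.tgt g = w then y w else 0 := by
    rw [← Finset.sum_filter, Finset.sum_const, Finset.filter_filter, nsmul_eq_mul]
    simp [adjMatrix, Nat.card_eq_fintype_card, Fintype.card_subtype]
  simp only [mulVec, dotProduct, hentry]
  rw [Finset.sum_comm]
  simp

theorem adjMatrix_mulVec_indicator (Φ : Hom G H) {B : Set G.V} (hB : G.Invariant B)
    (hcov : ∀ v ∈ B, Φ.RightCoveringAt v) (x : H.V → ℂ) :
    G.adjMatrix *ᵥ B.indicator (x ∘ Φ.onV) = B.indicator ((H.adjMatrix *ᵥ x) ∘ Φ.onV) := by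
  classical
  ext v
  rw [adjMatrix_mulVec]
  by_cases hv : v ∈ B
  · rw [Set.indicator_of_mem hv, Function.comp_apply, adjMatrix_mulVec]
    refine Finset.sum_nbij Φ.onE ?_ ?_ ?_ ?_
    · simpa [Set.MapsTo, outEdges] using (hcov v hv).mapsTo
    · simpa [outEdges] using (hcov v hv).injOn
    · simpa [outEdges] using (hcov v hv).surjOn
    · intro g hg
      obtain rfl := (Finset.mem_filter_univ g).1 hg
      rw [Set.indicator_of_mem ((hB g).1 hv), Function.comp_apply, Φ.tgt_onE]
  · rw [Set.indicator_of_notMem hv]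
    refine Finset.sum_eq_zero fun g hg => Set.indicator_of_notMem ?_ _
    rwa [← hB g, (Finset.mem_filter_univ g).1 hg]

open Classical in
theorem mem_spectrum_adjMatrix_of_rightCoveringAt (Φ : Hom G H) {B : Set G.V}
    (hB : G.Invariant B) (hsurj : Φ.onV '' B = Set.univ) (hcov : ∀ v ∈ B, Φ.RightCoveringAt v)
    {μ : ℂ} (hμ : μ ∈ spectrum ℂ H.adjMatrix) : μ ∈ spectrum ℂ G.adjMatrix := by
  rw [← spectrum_toLin', ← Module.End.hasEigenvalue_iff_mem_spectrum] at hμ ⊢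
  obtain ⟨x, hx⟩ := hμ.exists_hasEigenvector
  refine Module.End.hasEigenvalue_of_hasEigenvector (x := B.indicator (x ∘ Φ.onV))
    (Module.End.hasEigenvector_iff.2 ⟨Module.End.mem_eigenspace_iff.2 ?_, ?_⟩)
  · have hx' : H.adjMatrix *ᵥ x = μ • x := hx.apply_eq_smul
    rw [toLin'_apply, adjMatrix_mulVec_indicator Φ hB hcov, hx']
    exact Set.indicator_const_smul B μ (x ∘ Φ.onV)
  · obtain ⟨I, hI⟩ := Function.ne_iff.1 hx.2
    obtain ⟨v, hv, rfl⟩ := hsurj.symm.subset (Set.mem_univ I)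
    exact Function.ne_iff.2 ⟨v, by simpa [hv] using hI⟩

theorem specRadius_le_of_rightCoveringAt (Φ : Hom G H) (hH : H.Irreducible) {B : Set G.V}
    (hB : G.Invariant B) (hne : B.Nonempty) (hcov : ∀ v ∈ B, Φ.RightCoveringAt v) :
    H.specRadius ≤ G.specRadius :=
  biSup_mono fun _ => mem_spectrum_adjMatrix_of_rightCoveringAt Φ hB
    (Φ.image_onV_eq_univ hH hB.forwardClosed hne hcov) hcov

theorem exists_not_rightCoveringAt_of_specRadius_lt (Φ : Hom G H) (hH : H.Irreducible)
    (hlt : G.specRadius < H.specRadius) (v : G.V) :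
    ∃ w ∈ G.weakComponent v, ¬ Φ.RightCoveringAt w := by
  by_contra! hcov
  exact hlt.not_ge <| specRadius_le_of_rightCoveringAt Φ hH (invariant_weakComponent v)
    ⟨v, mem_weakComponent_self v⟩ hcov

open Classical in
theorem nonempty_edges_of_specRadius_pos (h : 0 < H.specRadius) : Nonempty H.E := by
  by_contra hE
  rw [not_nonempty_iff] at hE
  have hzero : H.adjMatrix = 0 := by
    ext I J
    simp [adjMatrix]
  exact h.ne' (by rw [specRadius, hzero, spectrum.spectralRadius_zero])

end SpectralRadius

end FinDigraph

theorem theorem3p3_general {G H : FinDigraph.{u}} (Φ : FinDigraph.Hom G H)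
    (hΦ : Φ.BiResolving) (hH : H.Irreducible) :
    (G.WeaklyConnected →
      ∃ (G' : FinDigraph.{u}) (Ψ : FinDigraph.Hom G' H),
        Ψ.BiCovering ∧ Ψ.IsExtension Φ ∧ G'.Irreducible ∧ Ψ.degree = Φ.degree) ∧
    (∀ n : ℕ, Nonempty H.E → (∀ v, ∃ w ∈ G.weakComponent v, ¬ Φ.RightCoveringAt w) →
      Φ.degree < n →
      ∃ (G' : FinDigraph.{u}) (Ψ : FinDigraph.Hom G' H),
        Ψ.BiCovering ∧ Ψ.IsExtension Φ ∧ G'.Irreducible ∧ Ψ.degree = n) := by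
  constructor
  · intro hG
    rcases isEmpty_or_nonempty H.V with hV | hV
    · have : IsEmpty G.V := Φ.onV.isEmpty
      exact ⟨G, Φ, ⟨isEmptyElim, isEmptyElim⟩, .refl Φ, isEmptyElim, rfl⟩
    · obtain ⟨K, Ψ, hΨ, hext, hdeg⟩ := hΦ.exists_biCovering_isExtension le_rfl
      exact ⟨K, Ψ, hΨ, hext, hext.irreducible_of_degree_le hΨ hH hG hdeg.le, hdeg⟩
  · rintro n ⟨e⟩ hG hn
    have : Nonempty H.V := ⟨H.src e⟩
    have : Nonempty H.E := ⟨e⟩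
    obtain ⟨K, Ψ, hΨ, hext, rfl⟩ := hΦ.exists_biCovering_isExtension hn.le
    obtain ⟨τ, hτ, hext', hirr⟩ := hext.exists_retarget_irreducible hΨ hH hG hn
    exact ⟨K.retarget τ, Ψ.retarget τ hτ, hΨ.retarget hτ, hext', hirr, rfl⟩

theorem theorem3p3 {G H : FinDigraph.{u}} (Φ : FinDigraph.Hom G H)
    (hΦ : Φ.BiResolving) (hH : H.Irreducible) :
    (G.WeaklyConnected →
      ∃ (G' : FinDigraph.{u}) (Ψ : FinDigraph.Hom G' H),
        Ψ.BiCovering ∧ Ψ.IsExtension Φ ∧ G'.Irreducible ∧ Ψ.degree = Φ.degree) ∧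
    (∀ n : ℕ, G.specRadius < H.specRadius → Φ.degree < n →
      ∃ (G' : FinDigraph.{u}) (Ψ : FinDigraph.Hom G' H),
        Ψ.BiCovering ∧ Ψ.IsExtension Φ ∧ G'.Irreducible ∧ Ψ.degree = n) :=
  (theorem3p3_general Φ hΦ hH).imp_right fun h n hlt => h n
    (FinDigraph.nonempty_edges_of_specRadius_pos (bot_le.trans_lt hlt))
    (FinDigraph.exists_not_rightCoveringAt_of_specRadius_lt Φ hH hlt)
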